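/- Let $d,k\in\mathbb N=\{0,1,2,\dots\}$, let $\Omega\subseteq\mathbb R^d$ be open, let $T\in\mathcal D'(\Omega)$ be a (complex-valued) distribution, and let $(f_n)_{n\in\mathbb N}$ be a sequence of (complex-valued) $C^k$ functions on $\Omega$ such that $\langle T-f_n,\rho\rangle\to 0$ as $n\to\infty$ for every $\rho\in\mathcal D(\Omega)$, where $\langle T-f_n,\rho\rangle=\langle T,\rho\rangle-\int_\Omega f_n\rho\,dx$. For $s\in\mathbb R$ say that $(f_n)$ is of class $(k,s)$ if $\sup_{x\in\omega}|\partial^m f_n(x)|=O(n^s)$ as $n\to\infty$ for every multi-index $m$ with $|m|\le k$ and every set $\omega$ whose closure is compact and contained in $\Omega$. For $R:\mathbb N\to[0,\infty)$ write $T-f_n=O(R(n))$ in $\mathcal D'(\Omega)$ if $\langle T-f_n,\rho\rangle=O(R(n))$ as $n\to\infty$ for every $\rho\in\mathcal D(\Omega)$. Assume that at least one of the following holds: (i) $(f_n)$ is of class $(k,a)$ for every $a>0$, and $T-f_n=O(n^{-b})$ in $\mathcal D'(\Omega)$ for some $b>0$; (ii) $(f_n)$ is of class $(k,s)$ for some $s>0$,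 and $T-f_n=O(R(n))$ in $\mathcal D'(\Omega)$ for some $R:\mathbb N\to[0,\infty)$ with $R(n)=O(n^{-a})$ for every $a>0$. Then $T\in C^{k-\eta}_{*,\mathrm{loc}}(\Omega)$ for every $\eta>0$. Here, for $\alpha\in\mathbb R$, $T\in C^{\alpha}_{*,\mathrm{loc}}(\Omega)$ means that $\rho T\in C^\alpha_*(\mathbb R^d)$ for every $\rho\in\mathcal D(\Omega)$, and $C^\alpha_*(\mathbb R^d)$ is the space of all $S\in\mathcal S'(\mathbb R^d)$ such that $$\sup_{x\in\mathbb R^d,\;j\ge 0}2^{\alpha j}\,|(S*\theta_{2^j})(x)|<\infty,\qquad \theta_{2^0}=\theta_1,\quad \theta_{2^j}(x)=2^{jd}\theta(2^jx)\ \ (j\ge1),$$ for all $\varepsilon>0$ and all $\theta_1,\theta\in\mathcal S(\mathbb R^d)$ with $|\hat\theta_1(u)|>0$ for $|u|\le2\varepsilon$, $|\hat\theta(u)|>0$ for $\varepsilon/2\le|u|\le2\varepsilon$, and $\int x^m\theta(x)\,dx=0$ for all multi-indices $|m|\le[\alpha]$, where $[\alpha]$ is the integral part of $\alpha$ (no moment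 condition if $\alpha<0$). (Finiteness for one such choice of $(\varepsilon,\theta_1,\theta)$ is well known to be equivalent to finiteness for every such choice.) -/

import Mathlib

open TopologicalSpace MeasureTheory Filter Asymptotics
open scoped Distributions SchwartzMap FourierTransform Topology

/-- The space `ℝ^d` with its Euclidean norm. -/
abbrev Rd (d : ℕ) : Type := EuclideanSpace ℝ (Fin d)

/-- `𝓓'(Ω)`: continuous `ℂ`-linear forms on the space `𝓓(Ω)` of complex-valued test functions on
`Ω`, the latter carrying its canonical LF topology. -/
abbrev Distr {d : ℕ} (Ω : Opens (Rd d)) : Type := 𝓓(Ω, ℂ) →L[ℂ] ℂ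

/-! ### Sequences of functions and their relation to a distribution -/

/-- The partial derivative `∂_{i 0} ∂_{i 1} ⋯ ∂_{i (r-1)} g` of order `r`. As `i` ranges over all
words of length `r`, these are all the partial derivatives `∂^m g` with `|m| = r`. -/
noncomputable def partialDeriv {d r : ℕ} (i : Fin r → Fin d) (g : Rd d → ℂ) (x : Rd d) : ℂ :=
  iteratedFDeriv ℝ r g x fun l => EuclideanSpace.single (i l) (1 : ℝ)

/-- The sequence `f` of functions on `Ω` is of class `(k, s)`: every `f n` is `C^k` on `Ω`, and
`sup_{x ∈ ω} |∂^m f_n(x)| = O(n^s)` as `n → ∞`, for all relatively compact `ω ⊂⊂ Ω` and all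
`|m| ≤ k`. (The functions are given on the whole space, but only their restrictions to the open
set `Ω` matter.) -/
def IsOfClass {d : ℕ} (Ω : Opens (Rd d)) (k : ℕ) (s : ℝ) (f : ℕ → Rd d → ℂ) : Prop :=
  (∀ n, ContDiffOn ℝ k (f n) Ω) ∧
  ∀ ω : Set (Rd d), IsCompact (closure ω) → closure ω ⊆ Ω →
    ∀ r ≤ k, ∀ i : Fin r → Fin d,
      ∃ C : ℝ, ∀ᶠ n : ℕ in atTop, ∀ x ∈ ω, ‖partialDeriv i (f n) x‖ ≤ C * (n : ℝ) ^ s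

/-- The pairing `⟨T - g, ρ⟩ = ⟨T, ρ⟩ - ∫_Ω g ρ` of the difference of a distribution `T` and a
locally integrable function `g` on `Ω` with a test function `ρ`. -/
noncomputable def pairDiff {d : ℕ} {Ω : Opens (Rd d)} (T : Distr Ω) (g : Rd d → ℂ)
    (ρ : 𝓓(Ω, ℂ)) : ℂ :=
  T ρ - ∫ x in (Ω : Set (Rd d)), g x * ρ x

/-- The sequence `f` is associated to `T`: `f n → T` weakly in `𝓓'(Ω)`. -/
def IsAssociated {d : ℕ} {Ω : Opens (Rd d)} (T : Distr Ω) (f : ℕ → Rd d → ℂ) : Prop :=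
  ∀ ρ : 𝓓(Ω, ℂ), Tendsto (fun n => pairDiff T (f n) ρ) atTop (𝓝 0)

/-- `T - f_n = O(R(n))` in `𝓓'(Ω)`: the estimate holds after pairing with each test function. -/
def HasRate {d : ℕ} {Ω : Opens (Rd d)} (T : Distr Ω) (f : ℕ → Rd d → ℂ) (R : ℕ → ℝ) : Prop :=
  ∀ ρ : 𝓓(Ω, ℂ), (fun n => pairDiff T (f n) ρ) =O[atTop] R

/-- `R : ℕ → ℝ₊` is rapidly decreasing. -/
def IsRapidlyDecreasing (R : ℕ → ℝ) : Prop :=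
  (∀ n, 0 ≤ R n) ∧ ∀ a : ℝ, 0 < a → R =O[atTop] fun n : ℕ => (n : ℝ) ^ (-a)

/-! ### Global Zygmund spaces -/

/-- The function `θ_t(x) = t^d θ(t x)`, for `t ≠ 0`. -/
noncomputable def dilate {d : ℕ} (t : ℝ) (ht : t ≠ 0) (θ : 𝓢(Rd d, ℂ)) : 𝓢(Rd d, ℂ) :=
  ((t : ℂ) ^ d) • SchwartzMap.compCLMOfContinuousLinearEquiv ℂ
    (ContinuousLinearEquiv.smulLeft (Units.mk0 t ht)) θ

theorem dilate_apply {d : ℕ} (t : ℝ) (ht : t ≠ 0) (θ : 𝓢(Rd d, ℂ)) (x : Rd d) :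
    dilate t ht θ x = (t : ℂ) ^ d * θ (t • x) := by
  rfl

/-- The Schwartz function `y ↦ θ(x - y)`. -/
noncomputable def reflectTranslate {d : ℕ} (x : Rd d) (θ : 𝓢(Rd d, ℂ)) : 𝓢(Rd d, ℂ) :=
  SchwartzMap.compSubConstCLM ℂ x
    (SchwartzMap.compCLMOfContinuousLinearEquiv ℂ (ContinuousLinearEquiv.neg ℝ) θ)

theorem reflectTranslate_apply {d : ℕ} (x : Rd d) (θ : 𝓢(Rd d, ℂ)) (y : Rd d) :
    reflectTranslate x θ y = θ (x - y) := by
  simp [reflectTranslate]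

/-- The convolution `(S ∗ θ)(x) = ⟨S, θ(x - ·)⟩` of a tempered distribution with a Schwartz
function. -/
noncomputable def conv {d : ℕ} (S : 𝓢'(Rd d, ℂ)) (θ : 𝓢(Rd d, ℂ)) (x : Rd d) : ℂ :=
  S (reflectTranslate x θ)

/-- The compatibility conditions between the two test functions that analyse regularity of order
`α`. For `α < 0` the integral part of `α` is negative, so that no moment condition remains.
(Another normalization of the Fourier transform only rescales `ε`.) -/
structure IsAnalysingPair {d : ℕ} (α ε : ℝ) (θ₁ θ : 𝓢(Rd d, ℂ)) : Prop where
  eps_pos : 0 < ε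
  low : ∀ u : Rd d, ‖u‖ ≤ 2 * ε → 0 < ‖𝓕 θ₁ u‖
  high : ∀ u : Rd d, ε / 2 ≤ ‖u‖ → ‖u‖ ≤ 2 * ε → 0 < ‖𝓕 θ u‖
  moments : ∀ m : Fin d → ℕ, ((∑ i, m i : ℕ) : ℤ) ≤ ⌊α⌋ →
    ∫ x : Rd d, ((∏ i, x i ^ m i : ℝ) : ℂ) * θ x = 0

open LineDeriv in
/-- All moments vanish when the Fourier transform vanishes near the origin. -/
theorem moments_eq_zero {d : ℕ} (l : List (Rd d)) : ∀ φ : 𝓢(Rd d, ℂ),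
    ((𝓕 φ : 𝓢(Rd d, ℂ)) : Rd d → ℂ) =ᶠ[𝓝 0] 0 →
    ∫ x : Rd d, (((l.map fun v => inner ℝ x v).prod : ℝ) : ℂ) * φ x = 0 := by
  induction l with
  | nil =>
    intro φ h
    have := h.eq_of_nhds
    rw [SchwartzMap.fourier_coe, Real.fourier_eq] at this
    simpa using this
  | cons v l ih =>
    intro φ h
    have hg : Function.HasTemperateGrowth (fun x : Rd d => inner ℝ x v) := by fun_prop
    have := ih (SchwartzMap.smulLeftCLM ℂ (fun x : Rd d => inner ℝ x v) φ) ?_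
    · rw [← this]
      congr 1
      ext x
      rw [SchwartzMap.smulLeftCLM_apply_apply hg]
      simp; ring
    · have h1 := SchwartzMap.lineDerivOp_fourier_eq φ v
      have h2 : ((∂_{v} (𝓕 φ) : 𝓢(Rd d, ℂ)) : Rd d → ℂ) =ᶠ[𝓝 0] 0 := by
        filter_upwards [h.eventuallyEq_nhds] with x hx
        rw [SchwartzMap.lineDerivOp_apply_eq_fderiv, hx.fderiv_eq]
        simp
      rw [h1] at h2
      rw [FourierTransform.fourier_smul] at h2
      filter_upwards [h2] with x hx
      have hne : (-(2 * (Real.pi:ℂ) * Complex.I)) ≠ 0 := by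
        simp [Real.pi_ne_zero]
      simpa [hne, Real.pi_ne_zero] using hx

/-- Analysing pairs exist for every order `α`. -/
theorem exists_isAnalysingPair {d : ℕ} (α : ℝ) : ∃ θ₁ θ : 𝓢(Rd d, ℂ), IsAnalysingPair α 1 θ₁ θ := by
  let b2 : ContDiffBump (0 : Rd d) := ⟨2, 3, by norm_num, by norm_num⟩
  let b1 : ContDiffBump (0 : Rd d) := ⟨1/8, 1/4, by norm_num, by norm_num⟩
  let f2 : Rd d → ℂ := fun x => (b2 x : ℂ)
  let f1 : Rd d → ℂ := fun x => (b1 x : ℂ)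
  have c2 : ContDiff ℝ (⊤ : ℕ∞) f2 := Complex.ofRealCLM.contDiff.comp b2.contDiff
  have c1 : ContDiff ℝ (⊤ : ℕ∞) f1 := Complex.ofRealCLM.contDiff.comp b1.contDiff
  have s2 : HasCompactSupport f2 := b2.hasCompactSupport.comp_left (g := Complex.ofReal) rfl
  have s1 : HasCompactSupport f1 := b1.hasCompactSupport.comp_left (g := Complex.ofReal) rfl
  let g2 := s2.toSchwartzMap c2
  let g1 := s1.toSchwartzMap c1
  have e2 : ∀ u, g2 u = (b2 u : ℂ) := fun u => rfl
  have e1 : ∀ u, g1 u = (b1 u : ℂ) := fun u => rfl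
  refine ⟨𝓕⁻ g2, 𝓕⁻ (g2 - g1), one_pos, ?_, ?_, ?_⟩
  · intro u hu
    rw [FourierTransform.fourier_fourierInv_eq, e2, b2.one_of_mem_closedBall (by simpa [b2] using hu)]
    simp
  · intro u hu hu'
    rw [FourierTransform.fourier_fourierInv_eq]
    change 0 < ‖g2 u - g1 u‖
    rw [e1, e2, b2.one_of_mem_closedBall (by simpa [b2] using hu'),
      b1.zero_of_le_dist (by simp [b1]; linarith)]
    simp
  · intro m _
    have := moments_eq_zero ((List.finRange d).flatMap fun i => List.replicate (m i)
      (EuclideanSpace.single i (1:ℝ))) (𝓕⁻ (g2 - g1)) ?_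
    · rw [← this]
      congr 1
      ext x
      congr 2
      rw [List.map_flatMap, List.flatMap_def, List.prod_flatten, List.map_map]
      simp [Fin.prod_univ_def, Function.comp_def, EuclideanSpace.inner_single_right]
    · rw [FourierTransform.fourier_fourierInv_eq]
      filter_upwards [Metric.closedBall_mem_nhds (0 : Rd d) (show (0:ℝ) < 1/8 by norm_num)] with u hu
      change g2 u - g1 u = 0
      rw [e1, e2, b1.one_of_mem_closedBall hu, b2.one_of_mem_closedBall]
      · simp
      · simp only [Metric.mem_closedBall, dist_zero_right, b2] at hu ⊢; linarith

/-- The sequence `θ_{2^0} = θ₁` and `θ_{2^j}(x) = 2^{jd} θ(2^j x)` for `j ≥ 1`. -/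
noncomputable def dyadicKernel {d : ℕ} (θ₁ θ : 𝓢(Rd d, ℂ)) (j : ℕ) : 𝓢(Rd d, ℂ) :=
  if j = 0 then θ₁ else dilate ((2 : ℝ) ^ j) (by positivity) θ

/-- The Zygmund space `C_*^α(ℝ^d)`: the tempered distributions `S` with
`sup_{x, j} 2^{αj} |(S ∗ θ_{2^j})(x)| < ∞`. Finiteness does not depend on the choice of
`ε`, `θ₁`, `θ`; it is required here for every choice, the formally strongest form. -/
def MemZygmund {d : ℕ} (α : ℝ) (S : 𝓢'(Rd d, ℂ)) : Prop :=
  ∀ (ε : ℝ) (θ₁ θ : 𝓢(Rd d, ℂ)), IsAnalysingPair α ε θ₁ θ →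
    ∃ C : ℝ, ∀ (j : ℕ) (x : Rd d),
      (2 : ℝ) ^ (α * j) * ‖conv S (dyadicKernel θ₁ θ j) x‖ ≤ C

/-! ### Local Zygmund spaces -/

/-- The product `ρ φ` of a test function with a Schwartz function, as a smooth function supported
in `K = supp ρ`, linearly in `φ`. -/
noncomputable def mulSupportedLM {d : ℕ} {Ω : Opens (Rd d)} (ρ : 𝓓(Ω, ℂ)) :
    𝓢(Rd d, ℂ) →ₗ[ℂ]
      𝓓_{(⟨tsupport ρ, ρ.hasCompactSupport⟩ : Compacts (Rd d))}(Rd d, ℂ) where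
  toFun φ := ⟨fun x => ρ x * φ x, ρ.contDiff.mul (φ.smooth ⊤), fun x hx => by
    have : ρ x = 0 := image_eq_zero_of_notMem_tsupport hx
    simp [this]⟩
  map_add' φ ψ := by ext x; exact mul_add _ _ _
  map_smul' c φ := by ext x; exact mul_left_comm _ _ _

theorem continuous_mulSupportedLM {d : ℕ} {Ω : Opens (Rd d)} (ρ : 𝓓(Ω, ℂ)) :
    Continuous (mulSupportedLM ρ) := by
  have hρ : Function.HasTemperateGrowth (ρ : Rd d → ℂ) :=
    ρ.hasCompactSupport.hasTemperateGrowth ρ.contDiff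
  refine WithSeminorms.continuous_of_continuous_comp
    (ContDiffMapSupportedIn.withSeminorms ℂ (Rd d) ℂ ⊤ _) _ fun i => ?_
  have hcont : Continuous (((SchwartzMap.seminorm ℂ 0 i : Seminorm ℂ 𝓢(Rd d, ℂ))).comp
      (SchwartzMap.smulLeftCLM ℂ (ρ : Rd d → ℂ)).toLinearMap) :=
    ((schwartz_withSeminorms ℂ (Rd d) ℂ).continuous_seminorm (0, i)).comp
      (SchwartzMap.smulLeftCLM ℂ (ρ : Rd d → ℂ)).continuous
  refine Seminorm.continuous_of_le hcont fun φ => ?_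
  rw [Seminorm.comp_apply, Seminorm.comp_apply,
    ContDiffMapSupportedIn.seminorm_top_le_iff ℂ (apply_nonneg _ _)]
  intro x _
  have heq : ((mulSupportedLM ρ φ : Rd d → ℂ)) =
      (SchwartzMap.smulLeftCLM ℂ (ρ : Rd d → ℂ) φ : Rd d → ℂ) := by
    rw [SchwartzMap.smulLeftCLM_apply hρ]
    rfl
  rw [heq]
  exact SchwartzMap.norm_iteratedFDeriv_le_seminorm ℂ _ i x

/-- The product `ρ T` of a distribution `T ∈ 𝓓'(Ω)` with a test function `ρ ∈ 𝓓(Ω)`, as a tempered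
distribution on `ℝ^d`: `⟨ρ T, φ⟩ = ⟨T, ρ φ⟩`. -/
noncomputable def Distr.localize {d : ℕ} {Ω : Opens (Rd d)} (T : Distr Ω) (ρ : 𝓓(Ω, ℂ)) :
    𝓢'(Rd d, ℂ) :=
  ContinuousLinearMap.toPointwiseConvergenceCLM _ _ _ _
    (T ∘L TestFunction.ofSupportedInCLM ℂ ρ.tsupport_subset ∘L
      ⟨mulSupportedLM ρ, continuous_mulSupportedLM ρ⟩)

theorem Distr.localize_apply {d : ℕ} {Ω : Opens (Rd d)} (T : Distr Ω) (ρ ψ : 𝓓(Ω, ℂ))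
    (φ : 𝓢(Rd d, ℂ)) (hψ : ∀ x, ψ x = ρ x * φ x) : T.localize ρ φ = T ψ := by
  change T _ = T ψ
  congr 1
  ext x
  exact (hψ x).symm

/-- The local Zygmund space `C_{*,loc}^α(Ω)`: `ρ T ∈ C_*^α(ℝ^d)` for every test function `ρ`. -/
def MemZygmundLoc {d : ℕ} {Ω : Opens (Rd d)} (α : ℝ) (T : Distr Ω) : Prop :=
  ∀ ρ : 𝓓(Ω, ℂ), MemZygmund α (T.localize ρ)

/-! For every `n`, `(ρT ∗ θ_t)(x)` splits as `⟨T - f_n, ρ θ_t(x - ·)⟩ + ((f_n ρ) ∗ θ_t)(x)`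
(`conv_localize_eq`). Uniform boundedness on the Fréchet space `𝓓_K`, `K = supp ρ`, turns the
pointwise rate into a bound by `R n` times a `C^N` norm
(`ContDiffMapSupportedIn.exists_bound_of_isBigO`). That norm is `O(t^(d+N))` for `ρ θ_t(x - ·)`, so
the first term is `O(R n * t^(d+N))`. In the second term the vanishing moments of `θ` remove the
Taylor polynomial of `f_n ρ`, leaving `O(n^s * t^(-M))` with `M = max(⌊α⌋ + 1, 0) ≤ k` and `α = k -
η` (`norm_integral_mul_dilate_le`). Take `t = 2^j`, `n ≈ 2^(pj)` and `R n = O(n^(-a))`. Both terms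
are `O(2^(-αj))` once `α + d + N ≤ pa` and `α + ps ≤ M` (`exists_dyadic_bound`). Since `α < M`, this
can be arranged: under (i) `a` is fixed, `p` is taken large, then `s` small; under (ii) `s` is
fixed, `p` is taken small, then `a` large. -/

/-! ### Uniform boundedness on `𝓓_K` -/

section Complete

variable {E F : Type*} [NormedAddCommGroup E] [NormedSpace ℝ E] [NormedAddCommGroup F]
  [NormedSpace ℝ F] {K : Compacts E}

/-- A limit of smooth functions supported in `K`, uniform for each derivative. -/
theorem ContDiffMapSupportedIn.exists_of_tendsto_structureMapCLM (u : ℕ → 𝓓_{K}(E, F))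
    (G : (i : ℕ) → BoundedContinuousFunction E (E [×i]→L[ℝ] F))
    (hG : ∀ i, Tendsto (fun n => ContDiffMapSupportedIn.structureMapCLM ℝ ⊤ i (u n)) atTop
      (𝓝 (G i))) :
    ∃ f : 𝓓_{K}(E, F), ∀ i, ContDiffMapSupportedIn.structureMapCLM ℝ ⊤ i f = G i := by
  have hunif : ∀ i, TendstoUniformly (fun n => iteratedFDeriv ℝ i (u n)) (G i) atTop := by
    intro i
    have := BoundedContinuousFunction.tendsto_iff_tendstoUniformly.1 (hG i)
    simpa only [ContDiffMapSupportedIn.structureMapCLM_top_apply] using this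
  have hderiv : ∀ i x, HasFDerivAt (G i) ((G (i + 1) x).curryLeft) x := by
    intro i x
    refine hasFDerivAt_of_tendstoUniformly (l := atTop)
      (f := fun n => iteratedFDeriv ℝ i (u n))
      (f' := fun n y => (iteratedFDeriv ℝ (i + 1) (u n) y).curryLeft)
      (g' := fun y => (G (i + 1) y).curryLeft) ?_ (fun n y => ?_)
      (fun y => (hunif i).tendsto_at y) x
    · exact (continuousMultilinearCurryLeftEquiv ℝ (fun _ : Fin (i + 1) => E)
        F).isometry.uniformContinuous.comp_tendstoUniformly (hunif (i + 1))
    · exact ((u n).contDiff.differentiable_iteratedFDeriv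
        (by exact_mod_cast WithTop.coe_lt_top i) y).hasFDerivAt
  -- Each limit is the derivative of the preceding one, so together they form a Taylor series, and
  -- `G 0` is smooth.
  have hts : HasFTaylorSeriesUpTo ((⊤ : ℕ∞) : WithTop ℕ∞)
      (fun x => (G 0 x).curry0) (fun x i => G i x) :=
    ⟨fun x => rfl, fun m _ x => hderiv m x, fun m _ => (G m).continuous⟩
  have hzero : ∀ x ∉ K, ∀ i, G i x = 0 := by
    intro x hx i
    refine tendsto_nhds_unique ((hunif i).tendsto_at x) ?_
    simp [(u _).iteratedFDeriv_zero_on_compl hx]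
  refine ⟨⟨fun x => (G 0 x).curry0, hts.contDiff, fun x hx => ?_⟩, fun i => ?_⟩
  · simp [hzero x hx 0]
  · ext1 x
    rw [ContDiffMapSupportedIn.structureMapCLM_top_apply]
    exact (hts.eq_iteratedFDeriv (by exact_mod_cast le_top) x).symm

/-- The uniformity is induced from a countable product of normed spaces. Hence completeness can be
tested on sequences. -/
instance ContDiffMapSupportedIn.isCountablyGenerated_uniformity :
    (uniformity 𝓓_{K}(E, F)).IsCountablyGenerated := by
  rw [← (ContDiffMapSupportedIn.isUniformEmbedding_pi_structureMapCLM
    (E := E) (F := F) (n := ⊤) (K := K) ℝ).isUniformInducing.comap_uniformity]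
  infer_instance

/-- With countable generation this makes `𝓓_K` a Baire space, hence barrelled, as the uniform
boundedness argument requires. -/
instance ContDiffMapSupportedIn.completeSpace [CompleteSpace F] : CompleteSpace 𝓓_{K}(E, F) := by
  refine UniformSpace.complete_of_cauchySeq_tendsto fun u hu => ?_
  have h := fun i => cauchySeq_tendsto_of_complete
    ((uniformContinuous_pi.1 (ContDiffMapSupportedIn.isUniformEmbedding_pi_structureMapCLM
      (E := E) (F := F) (n := ⊤) (K := K) ℝ).isUniformInducing.uniformContinuous i).comp_cauchySeq
        hu)
  choose G hG using h
  obtain ⟨f, hf⟩ := ContDiffMapSupportedIn.exists_of_tendsto_structureMapCLM u G hG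
  refine ⟨f, ?_⟩
  rw [(ContDiffMapSupportedIn.isUniformEmbedding_pi_structureMapCLM
    (E := E) (F := F) (n := ⊤) (K := K) ℝ).isUniformInducing.isInducing.tendsto_nhds_iff,
    tendsto_pi_nhds]
  intro i
  have := hG i
  rw [← hf i] at this
  exact this

end Complete

/-- A sequence of continuous linear forms on `𝓓_K` that is pointwise `O(R n)` is so uniformly with
respect to some `C^N`-norm. -/
theorem ContDiffMapSupportedIn.exists_bound_of_isBigO {E : Type*} [NormedAddCommGroup E]
    [NormedSpace ℝ E] {K : Compacts E} (Λ : ℕ → 𝓓_{K}(E, ℂ) →L[ℂ] ℂ) {R : ℕ → ℝ}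
    (hR : ∀ n, 0 < R n) (h : ∀ φ, (fun n => Λ n φ) =O[atTop] R) :
    ∃ (N : ℕ) (C : ℝ), 0 ≤ C ∧ ∀ (n : ℕ) (φ : 𝓓_{K}(E, ℂ)) (B : ℝ), 0 ≤ B →
      (∀ i ≤ N, ∀ x, ‖iteratedFDeriv ℝ i φ x‖ ≤ B) → ‖Λ n φ‖ ≤ C * R n * B := by
  let p : ℕ → Seminorm ℂ 𝓓_{K}(E, ℂ) := fun n =>
    (normSeminorm ℂ ℂ).comp ((((R n)⁻¹ : ℝ) : ℂ) • Λ n).toLinearMap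
  have hp : ∀ n φ, p n φ = (R n)⁻¹ * ‖Λ n φ‖ := by
    intro n φ
    simp [p, abs_of_pos (hR n)]
  have hbdd : BddAbove (Set.range p) := by
    rw [Seminorm.bddAbove_range_iff]
    intro φ
    obtain ⟨c, hc⟩ := (h φ).bound
    -- An eventual bound along `ℕ` bounds the whole sequence, so the final estimate holds for every
    -- `n`.
    refine Filter.IsBoundedUnder.bddAbove_range ⟨c, ?_⟩
    rw [eventually_map]
    filter_upwards [hc] with n hn
    rw [hp, inv_mul_le_iff₀ (hR n), mul_comm]
    simpa [abs_of_pos (hR n)] using hn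
  have hcont : Continuous (⨆ n, p n) := Seminorm.continuous_iSup p
    (fun n => continuous_norm.comp ((((R n)⁻¹ : ℝ) : ℂ) • Λ n).continuous) hbdd
  rw [← Seminorm.coe_iSup_eq hbdd] at hcont
  obtain ⟨s, C, -, hs⟩ := Seminorm.bound_of_continuous
    (ContDiffMapSupportedIn.withSeminorms ℂ E ℂ ⊤ K) _ hcont
  -- `N` is the highest order among the finitely many seminorms that dominate the supremum.
  refine ⟨s.sup id, C, C.2, fun n φ B hB hφ => ?_⟩
  have h1 : p n φ ≤ (⨆ n, p n) φ := by
    rw [Seminorm.coe_iSup_eq hbdd, iSup_apply]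
    exact le_ciSup (f := fun n => p n φ) (Seminorm.bddAbove_range_iff.1 hbdd φ) n
  have h2 := h1.trans (hs φ)
  have h3 : (s.sup (ContDiffMapSupportedIn.seminorm ℂ E ℂ ⊤ K)) φ ≤ B := by
    refine Seminorm.finset_sup_apply_le hB fun i hi => ?_
    rw [ContDiffMapSupportedIn.seminorm_top_le_iff ℂ hB]
    exact fun x _ => hφ i (Finset.le_sup (f := id) hi) x
  rw [hp, inv_mul_le_iff₀ (hR n)] at h2
  refine h2.trans ?_
  rw [mul_comm (C : ℝ), mul_assoc]
  exact mul_le_mul_of_nonneg_left (mul_le_mul_of_nonneg_left h3 C.2) (hR n).le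

/-! ### Kernels with vanishing moments -/

/-- Link between coordinates and tensors: the class condition bounds partial derivatives and the
moment condition concerns monomials, whereas Taylor's formula involves the full multilinear
derivative. -/
theorem multilinear_apply_eq_sum {d r : ℕ}
    (A : ContinuousMultilinearMap ℝ (fun _ : Fin r => Rd d) ℂ) (v : Fin r → Rd d) :
    A v = ∑ i : Fin r → Fin d,
      ((∏ l, v l (i l) : ℝ) : ℂ) * A fun l => EuclideanSpace.single (i l) (1 : ℝ) := by
  have hv : v = fun l => ∑ c, v l c • EuclideanSpace.single c (1 : ℝ) := by
    funext l
    ext c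
    simp [Finset.sum_apply, Pi.single_apply]
  conv_lhs => rw [hv]
  rw [A.map_sum]
  refine Finset.sum_congr rfl fun i _ => ?_
  rw [A.map_smul_univ (fun l => v l (i l))]
  simp

theorem norm_multilinear_le_of_basis {d r : ℕ}
    (A : ContinuousMultilinearMap ℝ (fun _ : Fin r => Rd d) ℂ) {B : ℝ} (hB : 0 ≤ B)
    (h : ∀ i : Fin r → Fin d, ‖A fun l => EuclideanSpace.single (i l) (1 : ℝ)‖ ≤ B) :
    ‖A‖ ≤ (d : ℝ) ^ r * B := by
  refine A.opNorm_le_bound (by positivity) fun v => ?_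
  rw [multilinear_apply_eq_sum A v]
  calc _ ≤ ∑ _i : Fin r → Fin d, (∏ l, ‖v l‖) * B := by
        refine norm_sum_le_of_le _ fun i _ => ?_
        rw [norm_mul, Complex.norm_real, norm_prod]
        gcongr with l
        · exact PiLp.norm_apply_le _ _
        · exact h i
    _ = _ := by simp; ring

theorem integrable_prod_coord_mul {d r : ℕ} (θ : 𝓢(Rd d, ℂ)) (i : Fin r → Fin d) :
    Integrable fun z : Rd d => ((∏ l, z (i l) : ℝ) : ℂ) * θ z := by
  refine (θ.integrable_pow_mul volume r).mono' ?_ (Eventually.of_forall fun z => ?_)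
  · have := θ.continuous
    exact Continuous.aestronglyMeasurable (by fun_prop)
  · rw [norm_mul, Complex.norm_real, norm_prod]
    gcongr
    calc _ ≤ ∏ _l : Fin r, ‖z‖ := by
          gcongr with l
          exact PiLp.norm_apply_le _ _
      _ = _ := by simp

/-- The monomial of a word depends only on how often each letter occurs; these counts form a
multi-index of order `r`. -/
theorem integral_prod_coord_mul_eq_zero {d r : ℕ} {θ : 𝓢(Rd d, ℂ)}
    (hθ : ∀ m : Fin d → ℕ, ∑ c, m c = r → ∫ x : Rd d, ((∏ c, x c ^ m c : ℝ) : ℂ) * θ x = 0)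
    (i : Fin r → Fin d) : ∫ z : Rd d, ((∏ l, z (i l) : ℝ) : ℂ) * θ z = 0 := by
  classical
  rw [← hθ (fun c => (Finset.univ.filter fun l => i l = c).card) ?_]
  · congr 1
    ext z
    congr 2
    rw [← Finset.prod_fiberwise Finset.univ i]
    refine Finset.prod_congr rfl fun c _ => ?_
    rw [Finset.prod_congr rfl (g := fun _ => z c), Finset.prod_const]
    intro l hl
    rw [(Finset.mem_filter.1 hl).2]
  · rw [← Finset.card_eq_sum_card_fiberwise (fun _ _ => Finset.mem_univ _)]
    simp

theorem integrable_multilinear_diag_mul {d r : ℕ} (θ : 𝓢(Rd d, ℂ))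
    (A : ContinuousMultilinearMap ℝ (fun _ : Fin r => Rd d) ℂ) (c : ℝ) :
    Integrable fun z : Rd d => A (fun _ => c • z) * θ z := by
  have hA : ∀ z : Rd d, A (fun _ => c • z) * θ z = ∑ i : Fin r → Fin d,
      (((∏ l, (c • z) (i l) : ℝ) : ℂ) * A fun l => EuclideanSpace.single (i l) (1 : ℝ)) * θ z :=
    fun z => by rw [multilinear_apply_eq_sum A, Finset.sum_mul]
  simp_rw [hA]
  refine integrable_finsetSum _ fun i _ => ?_
  refine ((integrable_prod_coord_mul θ i).const_mul ((∏ _l : Fin r, c : ℝ) *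
    A fun l => EuclideanSpace.single (i l) (1 : ℝ))).congr (Eventually.of_forall fun z => ?_)
  simp [Finset.prod_mul_distrib]
  ring

/-- This annihilates the degree `r` term of a Taylor polynomial; `c` will be the factor `-t⁻¹`
produced by rescaling. -/
theorem integral_multilinear_diag_mul {d r : ℕ} {θ : 𝓢(Rd d, ℂ)}
    (hθ : ∀ m : Fin d → ℕ, ∑ c, m c = r → ∫ x : Rd d, ((∏ c, x c ^ m c : ℝ) : ℂ) * θ x = 0)
    (A : ContinuousMultilinearMap ℝ (fun _ : Fin r => Rd d) ℂ) (c : ℝ) :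
    ∫ z : Rd d, A (fun _ => c • z) * θ z = 0 := by
  have : ∀ z : Rd d, A (fun _ => c • z) * θ z = ∑ i : Fin r → Fin d,
      ((∏ _l : Fin r, c : ℝ) * A fun l => EuclideanSpace.single (i l) (1 : ℝ)) *
        (((∏ l, z (i l) : ℝ) : ℂ) * θ z) := by
    intro z
    rw [A.map_smul_univ (fun _ => c), multilinear_apply_eq_sum A, Finset.smul_sum,
      Finset.sum_mul]
    refine Finset.sum_congr rfl fun i _ => ?_
    simp
    ring
  simp_rw [this]
  rw [integral_finsetSum _ fun i _ => (integrable_prod_coord_mul θ i).const_mul _]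
  simp_rw [integral_const_mul, integral_prod_coord_mul_eq_zero hθ]
  simp

/-- Taylor's theorem with a bound on the remainder. -/
theorem norm_sub_taylor_le {E F : Type*} [NormedAddCommGroup E] [NormedSpace ℝ E]
    [NormedAddCommGroup F] [NormedSpace ℝ F] [CompleteSpace F] {g : E → F} {M : ℕ} {B : ℝ}
    (hg : ContDiff ℝ M g) (hB : ∀ x, ‖iteratedFDeriv ℝ M g x‖ ≤ B) (x h : E) :
    ‖g (x + h) - ∑ r ∈ Finset.range M, (r.factorial : ℝ)⁻¹ • iteratedFDeriv ℝ r g x fun _ => h‖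
      ≤ B * ‖h‖ ^ M := by
  cases M with
  | zero => simpa using hB (x + h)
  | succ n =>
    rw [map_add_eq_sum_add_integral_iteratedFDeriv (f := g) (x := x) (y := h) (n := n)
      (fun t _ => hg.contDiffAt.of_le (by norm_cast)), add_sub_cancel_left, norm_smul]
    have hB0 : 0 ≤ B := (norm_nonneg _).trans (hB x)
    have h1 : ‖((n.factorial : ℝ)⁻¹)‖ ≤ 1 := by
      rw [norm_inv, Real.norm_natCast]
      exact inv_le_one_of_one_le₀ (by exact_mod_cast n.factorial_pos)
    have h2 : ‖∫ t in (0 : ℝ)..1, (1 - t) ^ n •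
        iteratedFDeriv ℝ (n + 1) g (x + t • h) (fun _ => h)‖ ≤ B * ‖h‖ ^ (n + 1) := by
      have := intervalIntegral.norm_integral_le_of_norm_le_const (a := 0) (b := 1)
        (C := B * ‖h‖ ^ (n + 1)) (f := fun t : ℝ => (1 - t) ^ n •
        iteratedFDeriv ℝ (n + 1) g (x + t • h) (fun _ => h)) ?_
      · simpa using this
      · intro t ht
        rw [Set.uIoc_of_le zero_le_one] at ht
        rw [norm_smul, norm_pow]
        have h3 : ‖1 - t‖ ^ n ≤ 1 := by
          refine pow_le_one₀ (norm_nonneg _) ?_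
          rw [Real.norm_eq_abs, abs_le]
          constructor <;> linarith [ht.1, ht.2]
        have h4 := (iteratedFDeriv ℝ (n + 1) g (x + t • h)).le_of_opNorm_le (hB _) (fun _ => h)
        simp only [Finset.prod_const, Finset.card_univ, Fintype.card_fin] at h4
        calc _ ≤ 1 * (B * ‖h‖ ^ (n + 1)) := by gcongr
          _ = _ := one_mul _
    calc _ ≤ 1 * (B * ‖h‖ ^ (n + 1)) := by gcongr
      _ = _ := one_mul _

/-- Integrating a `C^M` function against a dilated kernel whose moments of order `< M` vanish. -/
theorem norm_integral_mul_dilate_le {d M : ℕ} {θ : 𝓢(Rd d, ℂ)}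
    (hθ : ∀ m : Fin d → ℕ, ∑ c, m c < M → ∫ x : Rd d, ((∏ c, x c ^ m c : ℝ) : ℂ) * θ x = 0)
    {g : Rd d → ℂ} (hg : ContDiff ℝ M g) {B : ℝ} (hB : ∀ x, ‖iteratedFDeriv ℝ M g x‖ ≤ B)
    {t : ℝ} (ht : 0 < t) (x : Rd d) :
    ‖∫ y, g y * dilate t ht.ne' θ (x - y)‖ ≤ (∫ z, ‖z‖ ^ M * ‖θ z‖) * B * t⁻¹ ^ M := by
  -- Substituting `y = x - z/t` absorbs the factor `t^d` of the dilation.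
  have hchange : ∫ y, g y * dilate t ht.ne' θ (x - y) = ∫ z, g (x + (-t⁻¹) • z) * θ z := by
    rw [← integral_sub_left_eq_self (fun y => g y * dilate t ht.ne' θ (x - y)) volume x]
    have := Measure.integral_comp_smul (volume : Measure (Rd d))
      (fun z => g (x + (-t⁻¹) • z) * θ z) t
    rw [finrank_euclideanSpace_fin, abs_of_pos (by positivity)] at this
    rw [← smul_inv_smul₀ (pow_ne_zero d ht.ne')
      (∫ z, g (x + (-t⁻¹) • z) * θ z), ← this, ← integral_smul]
    congr 1
    ext y
    rw [smul_smul, neg_mul, inv_mul_cancel₀ ht.ne', dilate_apply]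
    simp [sub_eq_add_neg]
    ring
  rw [hchange]
  set P : Rd d → ℂ := fun z => ∑ r ∈ Finset.range M, (r.factorial : ℝ)⁻¹ •
    iteratedFDeriv ℝ r g x fun _ => (-t⁻¹) • z with hP
  have hPint : ∀ r, Integrable fun z : Rd d => ((r.factorial : ℝ)⁻¹ : ℂ) *
      ((iteratedFDeriv ℝ r g x fun _ => (-t⁻¹) • z) * θ z) := fun r =>
    (integrable_multilinear_diag_mul θ (iteratedFDeriv ℝ r g x) (-t⁻¹)).const_mul _
  have hPθ : ∀ z, P z * θ z = ∑ r ∈ Finset.range M, ((r.factorial : ℝ)⁻¹ : ℂ) *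
      ((iteratedFDeriv ℝ r g x fun _ => (-t⁻¹) • z) * θ z) := by
    intro z
    simp only [hP, Finset.sum_mul]
    refine Finset.sum_congr rfl fun r _ => ?_
    simp [mul_assoc]
  have hP0 : ∫ z, P z * θ z = 0 := by
    simp_rw [hPθ]
    rw [integral_finsetSum _ fun r _ => hPint r]
    refine Finset.sum_eq_zero fun r hr => ?_
    rw [integral_const_mul, integral_multilinear_diag_mul, mul_zero]
    exact fun m hm => hθ m (hm ▸ Finset.mem_range.1 hr)
  have hPi : Integrable fun z => P z * θ z := by
    simp_rw [hPθ]
    exact integrable_finsetSum _ fun r _ => hPint r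
  have hbound : ∀ z, ‖g (x + (-t⁻¹) • z) * θ z - P z * θ z‖ ≤
      B * t⁻¹ ^ M * (‖z‖ ^ M * ‖θ z‖) := by
    intro z
    rw [← sub_mul, norm_mul]
    have := norm_sub_taylor_le hg hB x ((-t⁻¹) • z)
    rw [norm_smul, norm_neg, norm_inv, Real.norm_of_nonneg ht.le, mul_pow] at this
    calc _ ≤ B * (t⁻¹ ^ M * ‖z‖ ^ M) * ‖θ z‖ := by gcongr
      _ = _ := by ring
  have hθint := (θ.integrable_pow_mul volume M).const_mul (B * t⁻¹ ^ M)
  -- Since `g` is not assumed bounded, integrability comes from the Taylor remainder bound.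
  have hdiff : Integrable fun z => g (x + (-t⁻¹) • z) * θ z - P z * θ z := by
    refine hθint.mono' ?_ (Eventually.of_forall hbound)
    refine AEStronglyMeasurable.sub (Continuous.aestronglyMeasurable ?_) hPi.aestronglyMeasurable
    have := θ.continuous
    have := hg.continuous
    fun_prop
  have hsplit : ∫ z, g (x + (-t⁻¹) • z) * θ z =
      ∫ z, (g (x + (-t⁻¹) • z) * θ z - P z * θ z) := by
    have := integral_add hdiff hPi
    simp only [sub_add_cancel, hP0, add_zero] at this
    exact this
  rw [hsplit]
  refine (norm_integral_le_of_norm_le hθint (Eventually.of_forall hbound)).trans_eq ?_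
  rw [integral_const_mul]
  ring

/-! ### Derivatives of products -/

/-- Each derivative costs one factor `t` beyond the normalization `t^d`; translations and
reflections leave the sup norm unchanged, whence uniformity in `x`. -/
theorem norm_iteratedFDeriv_reflectTranslate_dilate_le {d : ℕ} (θ : 𝓢(Rd d, ℂ)) {t : ℝ}
    (ht : 0 < t) (x y : Rd d) (i : ℕ) :
    ‖iteratedFDeriv ℝ i (reflectTranslate x (dilate t ht.ne' θ)) y‖ ≤
      t ^ (d + i) * SchwartzMap.seminorm ℂ 0 i θ := by
  let A : Rd d →L[ℝ] Rd d := (-t) • ContinuousLinearMap.id ℝ (Rd d)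
  let ψ : Rd d → ℂ := fun z => θ (z + t • x)
  have hψ : ContDiff ℝ i ψ := (θ.smooth i).comp (by fun_prop)
  have heq : (reflectTranslate x (dilate t ht.ne' θ) : Rd d → ℂ) =
      (((t : ℂ) ^ d) • (ψ ∘ A)) := by
    ext y
    rw [reflectTranslate_apply, dilate_apply]
    simp [ψ, A, sub_eq_add_neg, add_comm]
  have hA : ‖A‖ ≤ t := by
    refine (norm_smul_le (-t) (ContinuousLinearMap.id ℝ (Rd d))).trans ?_
    rw [norm_neg, Real.norm_of_nonneg ht.le]
    exact mul_le_of_le_one_right ht.le ContinuousLinearMap.norm_id_le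
  rw [heq, iteratedFDeriv_const_smul_apply (a := (t : ℂ) ^ d) (hψ.comp A.contDiff).contDiffAt, norm_smul,
    A.iteratedFDeriv_comp_right hψ y le_rfl, pow_add, mul_assoc]
  have h1 : ‖iteratedFDeriv ℝ i ψ (A y)‖ ≤ SchwartzMap.seminorm ℂ 0 i θ := by
    simp only [ψ]
    rw [iteratedFDeriv_comp_add_right]
    exact θ.norm_iteratedFDeriv_le_seminorm ℂ i _
  have h2 := (ContinuousMultilinearMap.norm_compContinuousLinearMap_le
    (iteratedFDeriv ℝ i ψ (A y)) fun _ => A)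
  simp only [Finset.prod_const, Finset.card_univ, Fintype.card_fin] at h2
  rw [norm_pow, Complex.norm_real, Real.norm_of_nonneg ht.le, mul_comm (t ^ i)]
  gcongr
  refine h2.trans ?_
  gcongr

/-- The `C^N`-norm of a test function times a dilated kernel. -/
theorem exists_norm_iteratedFDeriv_mul_dilate_le {d : ℕ} {Ω : Opens (Rd d)} (ρ : 𝓓(Ω, ℂ))
    (θ : 𝓢(Rd d, ℂ)) (N : ℕ) :
    ∃ C : ℝ, 0 ≤ C ∧ ∀ (t : ℝ) (ht : 0 < t), 1 ≤ t → ∀ x, ∀ i ≤ N, ∀ y,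
      ‖iteratedFDeriv ℝ i (mulSupportedLM ρ (reflectTranslate x (dilate t ht.ne' θ))) y‖ ≤
        C * t ^ (d + N) := by
  have hρ : ∀ i, ∃ c : ℝ, ∀ y, ‖iteratedFDeriv ℝ i ρ y‖ ≤ c := fun i =>
    (ρ.contDiff.continuous_iteratedFDeriv (by exact_mod_cast le_top)).bounded_above_of_compact_support
      (ρ.hasCompactSupport.iteratedFDeriv i)
  choose c hc using hρ
  have hc0 : ∀ i, 0 ≤ c i := fun i => (norm_nonneg _).trans (hc i 0)
  let D : ℕ → ℝ := fun i => ∑ l ∈ Finset.range (i + 1),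
    (i.choose l : ℝ) * c l * SchwartzMap.seminorm ℂ 0 (i - l) θ
  have hD : ∀ i, 0 ≤ D i := fun i => Finset.sum_nonneg fun l _ => by
    have := hc0 l
    positivity
  refine ⟨∑ i ∈ Finset.range (N + 1), D i, Finset.sum_nonneg fun i _ => hD i, ?_⟩
  intro t ht h1 x i hi y
  set κ := reflectTranslate x (dilate t ht.ne' θ) with hκ
  have hmul : (mulSupportedLM ρ κ : Rd d → ℂ) = fun y => ρ y * κ y := rfl
  rw [hmul]
  calc _ ≤ ∑ l ∈ Finset.range (i + 1), (i.choose l : ℝ) * ‖iteratedFDeriv ℝ l ρ y‖ *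
        ‖iteratedFDeriv ℝ (i - l) κ y‖ :=
      norm_iteratedFDeriv_mul_le (N := i) (ρ.contDiff.of_le (by exact_mod_cast le_top))
        (κ.smooth i) y le_rfl
    _ ≤ ∑ l ∈ Finset.range (i + 1), (i.choose l : ℝ) * c l *
        (t ^ (d + N) * SchwartzMap.seminorm ℂ 0 (i - l) θ) := by
      have hpos : ∀ l, 0 ≤ SchwartzMap.seminorm ℂ 0 (i - l) θ := fun l => apply_nonneg _ _
      gcongr with l hl
      · exact mul_nonneg (Nat.cast_nonneg _) (hc0 l)
      · exact hc l y
      -- As `1 ≤ t`, every order `i - l ≤ N` is majorized by the worst power.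
      · refine (norm_iteratedFDeriv_reflectTranslate_dilate_le θ ht x y (i - l)).trans ?_
        gcongr
        omega
    _ = D i * t ^ (d + N) := by
      rw [Finset.sum_mul]
      exact Finset.sum_congr rfl fun l _ => by ring
    _ ≤ _ := by
      gcongr
      exact Finset.single_le_sum (fun i _ => hD i) (Finset.mem_range.2 (by omega))

/-! ### The regularizing functions -/

/-- The values of `g` off `Ω` are arbitrary, but the product vanishes on the open complement of
`tsupport ρ`, which together with `Ω` covers the space. -/
theorem contDiff_mul_testFunction {d k : ℕ} {Ω : Opens (Rd d)} {g : Rd d → ℂ}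
    (hg : ContDiffOn ℝ k g Ω) (ρ : 𝓓(Ω, ℂ)) : ContDiff ℝ k fun x => g x * ρ x := by
  rw [contDiff_iff_contDiffAt]
  intro x
  by_cases hx : x ∈ tsupport ρ
  · exact ((hg x (ρ.tsupport_subset hx)).contDiffAt
      (Ω.isOpen.mem_nhds (ρ.tsupport_subset hx))).mul
      (ρ.contDiff.of_le (by exact_mod_cast le_top)).contDiffAt
  · refine (contDiffAt_const (c := (0 : ℂ))).congr_of_eventuallyEq ?_
    filter_upwards [(isClosed_tsupport ρ).isOpen_compl.mem_nhds hx] with y hy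
    rw [image_eq_zero_of_notMem_tsupport hy, mul_zero]

/-- If `f` is of class `(k, s)`, the derivatives of order `M ≤ k` of `f n * ρ` are `O(n ^ s)`,
uniformly on the whole space. -/
theorem IsOfClass.exists_norm_iteratedFDeriv_mul_le {d k : ℕ} {Ω : Opens (Rd d)} {s : ℝ}
    {f : ℕ → Rd d → ℂ} (hf : IsOfClass Ω k s f) (ρ : 𝓓(Ω, ℂ)) {M : ℕ} (hM : M ≤ k) :
    ∃ C : ℝ, 0 ≤ C ∧ ∀ᶠ n : ℕ in atTop, ∀ x,
      ‖iteratedFDeriv ℝ M (fun x => f n x * ρ x) x‖ ≤ C * (n : ℝ) ^ s := by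
  have hcpt : IsCompact (closure (tsupport ρ)) := by
    rw [(isClosed_tsupport ρ).closure_eq]
    exact ρ.hasCompactSupport
  have hsub : closure (tsupport ρ) ⊆ Ω := by
    rw [(isClosed_tsupport ρ).closure_eq]
    exact ρ.tsupport_subset
  -- The condition `r ≤ k` is kept inside so that `choose` yields a constant for every `r`.
  have hfr : ∀ r, ∃ c : ℝ, 0 ≤ c ∧ (r ≤ k → ∀ᶠ n : ℕ in atTop, ∀ x ∈ tsupport ρ,
      ‖iteratedFDeriv ℝ r (f n) x‖ ≤ c * (n : ℝ) ^ s) := by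
    intro r
    by_cases hr : r ≤ k
    · choose c hc using hf.2 (tsupport ρ) hcpt hsub r hr
      refine ⟨(d : ℝ) ^ r * ∑ i, |c i|, by positivity, fun _ => ?_⟩
      filter_upwards [eventually_all.2 hc] with n hn x hx
      rw [mul_assoc]
      refine norm_multilinear_le_of_basis _ (by positivity) fun i => (hn i x hx).trans ?_
      gcongr
      exact (le_abs_self _).trans
        (Finset.single_le_sum (f := fun i => |c i|) (fun i _ => abs_nonneg _)
          (Finset.mem_univ i))
    · exact ⟨0, le_rfl, fun h => absurd h hr⟩
  choose c hc0 hc using hfr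
  have hρ : ∀ i, ∃ b : ℝ, ∀ y, ‖iteratedFDeriv ℝ i ρ y‖ ≤ b := fun i =>
    (ρ.contDiff.continuous_iteratedFDeriv (by exact_mod_cast le_top)).bounded_above_of_compact_support
      (ρ.hasCompactSupport.iteratedFDeriv i)
  choose b hb using hρ
  have hb0 : ∀ i, 0 ≤ b i := fun i => (norm_nonneg _).trans (hb i 0)
  refine ⟨∑ l ∈ Finset.range (M + 1), (M.choose l : ℝ) * c l * b (M - l),
    Finset.sum_nonneg fun l _ => mul_nonneg (mul_nonneg (Nat.cast_nonneg _) (hc0 l)) (hb0 _), ?_⟩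
  have hev : ∀ᶠ n : ℕ in atTop, ∀ l ∈ Finset.range (M + 1), ∀ x ∈ tsupport ρ,
      ‖iteratedFDeriv ℝ l (f n) x‖ ≤ c l * (n : ℝ) ^ s :=
    (Finset.eventually_all _).2 fun l hl => hc l (by have := Finset.mem_range.1 hl; omega)
  filter_upwards [hev] with n hn x
  by_cases hx : x ∈ tsupport ρ
  · have hxΩ : x ∈ (Ω : Set (Rd d)) := ρ.tsupport_subset hx
    have := norm_iteratedFDerivWithin_mul_le (n := M) (N := M)
      ((hf.1 n).of_le (by exact_mod_cast hM))
      (ρ.contDiff.of_le (by exact_mod_cast le_top)).contDiffOn Ω.isOpen.uniqueDiffOn hxΩ le_rfl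
    simp only [iteratedFDerivWithin_of_isOpen _ Ω.isOpen hxΩ] at this
    refine this.trans ?_
    rw [Finset.sum_mul]
    refine Finset.sum_le_sum fun l hl => ?_
    calc _ ≤ (M.choose l : ℝ) * (c l * (n : ℝ) ^ s) * b (M - l) := by
          have := hc0 l
          gcongr
          · exact hn l hl x hx
          · exact hb _ _
      _ = _ := by ring
  · have h0 : (fun x => f n x * ρ x) =ᶠ[𝓝 x] fun _ => 0 := by
      filter_upwards [(isClosed_tsupport ρ).isOpen_compl.mem_nhds hx] with y hy
      rw [image_eq_zero_of_notMem_tsupport hy, mul_zero]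
    rw [(h0.iteratedFDeriv ℝ M).eq_of_nhds]
    simp only [iteratedFDeriv_fun_zero, Pi.zero_apply, norm_zero]
    exact mul_nonneg (Finset.sum_nonneg fun l _ =>
      mul_nonneg (mul_nonneg (Nat.cast_nonneg _) (hc0 l)) (hb0 _)) (by positivity)

/-! ### The difference between the distribution and its regularization -/

/-- The linear form `φ ↦ ⟨T - g, φ⟩` on smooth functions supported in the support of `ρ`. -/
noncomputable def pairDiffCLM {d : ℕ} {Ω : Opens (Rd d)} (T : Distr Ω) (g : Rd d → ℂ)
    (ρ : 𝓓(Ω, ℂ)) :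
    𝓓_{(⟨tsupport ρ, ρ.hasCompactSupport⟩ : Compacts (Rd d))}(Rd d, ℂ) →L[ℂ] ℂ :=
  T ∘L TestFunction.ofSupportedInCLM ℂ ρ.tsupport_subset -
    ContDiffMapSupportedIn.integralAgainstBilinCLM (ContinuousLinearMap.mul ℂ ℂ) volume g

theorem pairDiffCLM_apply {d : ℕ} {Ω : Opens (Rd d)} (T : Distr Ω) {g : Rd d → ℂ}
    (hg : ContinuousOn g Ω) (ρ : 𝓓(Ω, ℂ))
    (φ : 𝓓_{(⟨tsupport ρ, ρ.hasCompactSupport⟩ : Compacts (Rd d))}(Rd d, ℂ)) :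
    pairDiffCLM T g ρ φ =
      T (TestFunction.ofSupportedIn ρ.tsupport_subset φ) - ∫ x, g x * φ x := by
  have hint : IntegrableOn g (⟨tsupport ρ, ρ.hasCompactSupport⟩ : Compacts (Rd d)) :=
    (hg.mono ρ.tsupport_subset).integrableOn_compact ρ.hasCompactSupport
  rw [pairDiffCLM, sub_apply,
    ContDiffMapSupportedIn.integralAgainstBilinCLM_eq_integral hint]
  simp [mul_comm]

theorem pairDiffCLM_eq_pairDiff {d : ℕ} {Ω : Opens (Rd d)} (T : Distr Ω) {g : Rd d → ℂ}
    (hg : ContinuousOn g Ω) (ρ : 𝓓(Ω, ℂ))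
    (φ : 𝓓_{(⟨tsupport ρ, ρ.hasCompactSupport⟩ : Compacts (Rd d))}(Rd d, ℂ)) :
    pairDiffCLM T g ρ φ = pairDiff T g (TestFunction.ofSupportedIn ρ.tsupport_subset φ) := by
  rw [pairDiffCLM_apply T hg, pairDiff, setIntegral_eq_integral_of_forall_compl_eq_zero]
  · rfl
  · intro x hx
    have : φ x = 0 := φ.zero_on_compl fun h => hx (ρ.tsupport_subset h)
    exact mul_eq_zero_of_right _ this

/-- Adding and subtracting `g`, with no constraint linking `g` to `θ`: later `g = f n`, with `n`
adapted to each frequency. -/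
theorem conv_localize_eq {d : ℕ} {Ω : Opens (Rd d)} (T : Distr Ω) {g : Rd d → ℂ}
    (hg : ContinuousOn g Ω) (ρ : 𝓓(Ω, ℂ)) (θ : 𝓢(Rd d, ℂ)) (x : Rd d) :
    conv (T.localize ρ) θ x = pairDiffCLM T g ρ (mulSupportedLM ρ (reflectTranslate x θ)) +
      ∫ y, g y * ρ y * θ (x - y) := by
  rw [pairDiffCLM_apply T hg]
  have : ∀ y, mulSupportedLM ρ (reflectTranslate x θ) y = ρ y * θ (x - y) := fun y => by
    rw [← reflectTranslate_apply]
    rfl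
  simp_rw [this, mul_assoc, sub_add_cancel]
  rfl

theorem HasRate.mono {d : ℕ} {Ω : Opens (Rd d)} {T : Distr Ω} {f : ℕ → Rd d → ℂ} {R R' : ℕ → ℝ}
    (h : HasRate T f R) (hR : ∀ n, |R n| ≤ R' n) : HasRate T f R' := fun ρ =>
  (h ρ).trans (IsBigO.of_bound 1 (Eventually.of_forall fun n => by
    simpa using (hR n).trans (le_abs_self _)))

/-- Combination of the rate of approximation with the bounds on the derivatives of the
approximating functions, at a single frequency. -/
theorem exists_norm_conv_localize_dilate_le {d k : ℕ} {Ω : Opens (Rd d)} {T : Distr Ω}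
    {f : ℕ → Rd d → ℂ} (hf : ∀ n, ContDiffOn ℝ k (f n) Ω) {R : ℕ → ℝ} (hR : ∀ n, 0 < R n)
    (h : HasRate T f R) (ρ : 𝓓(Ω, ℂ)) :
    ∃ N : ℕ, ∀ s, IsOfClass Ω k s f → ∀ (θ : 𝓢(Rd d, ℂ)) (M : ℕ), M ≤ k →
      (∀ m : Fin d → ℕ, ∑ c, m c < M → ∫ x : Rd d, ((∏ c, x c ^ m c : ℝ) : ℂ) * θ x = 0) →
      ∃ C : ℝ, 0 ≤ C ∧ ∀ᶠ n : ℕ in atTop, ∀ (t : ℝ) (ht : 0 < t), 1 ≤ t → ∀ x,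
        ‖conv (T.localize ρ) (dilate t ht.ne' θ) x‖ ≤
          C * (R n * t ^ (d + N) + (n : ℝ) ^ s * t⁻¹ ^ M) := by
  obtain ⟨N, C₁, hC₁, h₁⟩ := ContDiffMapSupportedIn.exists_bound_of_isBigO
    (fun n => pairDiffCLM T (f n) ρ) hR fun φ => by
      simp_rw [pairDiffCLM_eq_pairDiff T (hf _).continuousOn]
      exact h _
  -- `N` depends only on `T`, `f`, `R` and `ρ`. It must be fixed before `s`, since the later choice
  -- of `s` depends on it.
  refine ⟨N, fun s hs θ M hM hθ => ?_⟩
  obtain ⟨C₂, hC₂, h₂⟩ := exists_norm_iteratedFDeriv_mul_dilate_le ρ θ N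
  obtain ⟨C₃, hC₃, h₃⟩ := hs.exists_norm_iteratedFDeriv_mul_le ρ hM
  set J := ∫ z, ‖z‖ ^ M * ‖θ z‖ with hJ
  have hJ0 : 0 ≤ J := integral_nonneg fun z => by positivity
  refine ⟨C₁ * C₂ + J * C₃, by positivity, ?_⟩
  filter_upwards [h₃] with n hn t ht ht1 x
  rw [conv_localize_eq T (hf n).continuousOn]
  have hRn := hR n
  have e1 := h₁ n (mulSupportedLM ρ (reflectTranslate x (dilate t ht.ne' θ)))
    (C₂ * t ^ (d + N)) (by positivity) (h₂ t ht ht1 x)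
  have e2 := norm_integral_mul_dilate_le hθ
    ((contDiff_mul_testFunction (hf n) ρ).of_le (by exact_mod_cast hM)) hn ht x
  refine (norm_add_le_of_le e1 e2).trans ?_
  have p1 : 0 ≤ R n * t ^ (d + N) := by positivity
  have p2 : 0 ≤ (n : ℝ) ^ s * t⁻¹ ^ M := by positivity
  calc _ = C₁ * C₂ * (R n * t ^ (d + N)) + J * C₃ * ((n : ℝ) ^ s * t⁻¹ ^ M) := by ring
    _ ≤ (C₁ * C₂ + J * C₃) * (R n * t ^ (d + N)) +
        (C₁ * C₂ + J * C₃) * ((n : ℝ) ^ s * t⁻¹ ^ M) := by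
      gcongr
      · exact le_add_of_nonneg_right (by positivity)
      · exact le_add_of_nonneg_left (by positivity)
    _ = _ := by ring

/-! ### Balancing the two error terms, and conclusion -/

/-- Optimization over `n ≈ 2 ^ (p j)`. -/
theorem exists_dyadic_bound {X : Type*} {F : ℕ → X → ℝ} {R : ℕ → ℝ} {D M : ℕ}
    {a s p α C : ℝ} (ha : 0 < a) (hs : 0 < s) (hp : 0 < p) (hC : 0 ≤ C)
    (hR : R =O[atTop] fun n : ℕ => (n : ℝ) ^ (-a))
    (hF : ∀ᶠ n : ℕ in atTop, ∀ j x,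
      F j x ≤ C * (R n * ((2 : ℝ) ^ j) ^ D + (n : ℝ) ^ s * ((2 : ℝ) ^ j)⁻¹ ^ M))
    (h1 : α + D ≤ p * a) (h2 : α + p * s ≤ M) :
    ∃ C' : ℝ, ∀ (j : ℕ) x, (2 : ℝ) ^ (α * j) * F j x ≤ C' := by
  obtain ⟨c, hc0, hc⟩ := hR.exists_nonneg
  obtain ⟨n₀, hn₀⟩ := eventually_atTop.1 (hF.and hc.bound)
  refine ⟨C * (c + ((n₀ : ℝ) + 2) ^ s), fun j x => ?_⟩
  -- The shift by `n₀` puts `n` where the eventual bounds hold; still `2^(pj) ≤ n ≤ (n₀ + 2)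
  -- 2^(pj)`.
  set n := n₀ + ⌈(2 : ℝ) ^ (p * j)⌉₊ with hn
  obtain ⟨e1, e2⟩ := hn₀ n (Nat.le_add_right _ _)
  have hpj : 1 ≤ (2 : ℝ) ^ (p * j) := Real.one_le_rpow (by norm_num) (by positivity)
  have hlow : (2 : ℝ) ^ (p * j) ≤ n := by
    rw [hn, Nat.cast_add]
    linarith [Nat.le_ceil ((2 : ℝ) ^ (p * j)), (Nat.cast_nonneg n₀ : (0 : ℝ) ≤ n₀)]
  have hup : (n : ℝ) ≤ (n₀ + 2) * (2 : ℝ) ^ (p * j) := by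
    rw [hn, Nat.cast_add]
    have := (Nat.ceil_lt_add_one (zero_le_one.trans hpj)).le
    nlinarith [(Nat.cast_nonneg n₀ : (0 : ℝ) ≤ n₀)]
  have hRn : R n ≤ c * (2 : ℝ) ^ (-(p * j * a)) := by
    refine (le_abs_self _).trans (e2.trans ?_)
    rw [Real.norm_of_nonneg (by positivity)]
    gcongr
    refine (Real.rpow_le_rpow_of_nonpos (by positivity) hlow (by linarith)).trans_eq ?_
    rw [← Real.rpow_mul (by norm_num)]
    congr 1
    ring
  have hns : (n : ℝ) ^ s ≤ ((n₀ : ℝ) + 2) ^ s * (2 : ℝ) ^ (p * j * s) := by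
    refine (Real.rpow_le_rpow (by positivity) hup hs.le).trans_eq ?_
    rw [Real.mul_rpow (by positivity) (by positivity), ← Real.rpow_mul (by norm_num)]
  have hD : ((2 : ℝ) ^ j) ^ D = (2 : ℝ) ^ ((j : ℝ) * D) := by
    rw [Real.rpow_mul (by norm_num), Real.rpow_natCast, Real.rpow_natCast]
  have hM : ((2 : ℝ) ^ j)⁻¹ ^ M = (2 : ℝ) ^ (-((j : ℝ) * M)) := by
    rw [inv_pow, Real.rpow_neg (by norm_num), Real.rpow_mul (by norm_num), Real.rpow_natCast,
      Real.rpow_natCast]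
  have hj : (0 : ℝ) ≤ j := Nat.cast_nonneg j
  calc (2 : ℝ) ^ (α * j) * F j x
      ≤ (2 : ℝ) ^ (α * j) * (C * (c * (2 : ℝ) ^ (-(p * j * a)) * (2 : ℝ) ^ ((j : ℝ) * D) +
        ((n₀ : ℝ) + 2) ^ s * (2 : ℝ) ^ (p * j * s) * (2 : ℝ) ^ (-((j : ℝ) * M)))) := by
        have e1 := e1 j x
        rw [hD, hM] at e1
        refine mul_le_mul_of_nonneg_left (e1.trans ?_) (by positivity)
        gcongr
    _ = C * (c * (2 : ℝ) ^ (α * j + (-(p * j * a) + (j : ℝ) * D)) +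
        ((n₀ : ℝ) + 2) ^ s * (2 : ℝ) ^ (α * j + (p * j * s + -((j : ℝ) * M)))) := by
        simp only [Real.rpow_add (show (0 : ℝ) < 2 by norm_num)]
        ring
    -- By `h1` and `h2` both exponents of `2` are nonpositive.
    _ ≤ C * (c * 1 + ((n₀ : ℝ) + 2) ^ s * 1) := by
        gcongr
        · exact Real.rpow_le_one_of_one_le_of_nonpos (by norm_num) (by nlinarith)
        · exact Real.rpow_le_one_of_one_le_of_nonpos (by norm_num) (by nlinarith)
    _ = _ := by ring

/-- A rate may be replaced by a positive one, without spoiling its polynomial decay. -/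
theorem HasRate.exists_pos {d : ℕ} {Ω : Opens (Rd d)} {T : Distr Ω} {f : ℕ → Rd d → ℂ} {R : ℕ → ℝ}
    (h : HasRate T f R) : ∃ R' : ℕ → ℝ, (∀ n, 0 < R' n) ∧ HasRate T f R' ∧
      ∀ a : ℝ, (R =O[atTop] fun n : ℕ => (n : ℝ) ^ (-a)) →
        R' =O[atTop] fun n : ℕ => (n : ℝ) ^ (-a) := by
  -- Positivity is needed to divide by the rate, and even `n^(-b)` is `0` at `n = 0`; the
  -- exponential decays faster than every power.
  refine ⟨fun n => |R n| + Real.exp (-1 * n), fun n => by positivity,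
    h.mono fun n => le_add_of_nonneg_right (Real.exp_pos _).le, fun a ha => ?_⟩
  exact ha.abs_left.add ((isLittleO_exp_neg_mul_rpow_atTop one_pos (-a)).comp_tendsto
    tendsto_natCast_atTop_atTop).isBigO

/-- The parameters of the dyadic estimate can be chosen under either hypothesis. -/
theorem exists_rate_and_parameters {d k : ℕ} {Ω : Opens (Rd d)} {T : Distr Ω} {f : ℕ → Rd d → ℂ}
    (h : ((∀ a : ℝ, 0 < a → IsOfClass Ω k a f) ∧
            ∃ b : ℝ, 0 < b ∧ HasRate T f fun n : ℕ => (n : ℝ) ^ (-b)) ∨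
          ((∃ s : ℝ, 0 < s ∧ IsOfClass Ω k s f) ∧
            ∃ R : ℕ → ℝ, IsRapidlyDecreasing R ∧ HasRate T f R)) :
    ∃ R : ℕ → ℝ, (∀ n, 0 < R n) ∧ HasRate T f R ∧ ∀ (D : ℝ) (δ : ℝ), 0 < δ →
      ∃ a s p : ℝ, 0 < a ∧ 0 < s ∧ 0 < p ∧ (R =O[atTop] fun n : ℕ => (n : ℝ) ^ (-a)) ∧
        IsOfClass Ω k s f ∧ D ≤ p * a ∧ p * s ≤ δ := by
  rcases h with ⟨hclass, b, hb, hrate⟩ | ⟨⟨s, hs, hclass⟩, R, hR, hrate⟩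
  · obtain ⟨R, hR0, hRrate, hRO⟩ := hrate.exists_pos
    refine ⟨R, hR0, hRrate, fun D δ hδ => ?_⟩
    -- Here `a = b` is given: `p` is fixed by `p * b = |D| + 1 ≥ D`, then `s = δ / p`. The `+ 1`
    -- keeps `p` positive.
    have hp : 0 < (|D| + 1) / b := by positivity
    refine ⟨b, δ / ((|D| + 1) / b), (|D| + 1) / b, hb, by positivity, hp,
      hRO b (isBigO_refl _ _), hclass _ (by positivity), ?_, (mul_div_cancel₀ _ hp.ne').le⟩
    rw [div_mul_cancel₀ _ hb.ne']
    linarith [le_abs_self D]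
  · obtain ⟨R', hR0, hRrate, hRO⟩ := hrate.exists_pos
    refine ⟨R', hR0, hRrate, fun D δ hδ => ?_⟩
    -- Here `s` is given: `p = δ / s`, and rapid decay permits `a = (|D| + 1) / p`.
    have hp : 0 < δ / s := by positivity
    have ha : 0 < (|D| + 1) / (δ / s) := by positivity
    refine ⟨(|D| + 1) / (δ / s), s, δ / s, ha, hs, hp, hRO _ (hR.2 _ ha), hclass, ?_,
      (div_mul_cancel₀ _ hs.ne').le⟩
    rw [mul_div_cancel₀ _ hp.ne']
    linarith [le_abs_self D]

theorem theorem4p4 {d : ℕ} (Ω : Opens (Rd d)) (k : ℕ) (T : Distr Ω) (f : ℕ → Rd d → ℂ)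
    (hf : ∀ n, ContDiffOn ℝ k (f n) Ω)
    (hassoc : IsAssociated T f)
    (h : ((∀ a : ℝ, 0 < a → IsOfClass Ω k a f) ∧
            ∃ b : ℝ, 0 < b ∧ HasRate T f fun n : ℕ => (n : ℝ) ^ (-b)) ∨
          ((∃ s : ℝ, 0 < s ∧ IsOfClass Ω k s f) ∧
            ∃ R : ℕ → ℝ, IsRapidlyDecreasing R ∧ HasRate T f R)) :
    ∀ η : ℝ, 0 < η → MemZygmundLoc ((k : ℝ) - η) T := by
  intro η hη ρ ε θ₁ θ hpair
  set α : ℝ := (k : ℝ) - η with hα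
  -- The moments of order `< M` are exactly those known to vanish; for `α < 0` this gives `M = 0`
  -- and none is needed.
  set M : ℕ := (⌊α⌋ + 1).toNat with hM
  have hαM : α < M := by
    have h1 : (⌊α⌋ + 1 : ℤ) ≤ (M : ℤ) := Int.self_le_toNat _
    have h2 : ((⌊α⌋ + 1 : ℤ) : ℝ) ≤ (M : ℝ) := by exact_mod_cast h1
    push_cast at h2
    linarith [Int.lt_floor_add_one α]
  have hMk : M ≤ k := by
    have : ⌊α⌋ < (k : ℤ) := by
      rw [Int.floor_lt]
      push_cast
      linarith
    omega
  have hmom : ∀ m : Fin d → ℕ, ∑ c, m c < M →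
      ∫ x : Rd d, ((∏ c, x c ^ m c : ℝ) : ℂ) * θ x = 0 := fun m hm =>
    hpair.moments m (by omega)
  obtain ⟨R, hR0, hRrate, hpar⟩ := exists_rate_and_parameters h
  obtain ⟨N, hN⟩ := exists_norm_conv_localize_dilate_le hf hR0 hRrate ρ
  obtain ⟨a, s, p, ha, hs, hp, hRO, hclass, hD, hδ⟩ :=
    hpar (α + (d + N : ℕ)) (M - α) (by linarith)
  obtain ⟨C, hC, hhigh⟩ := hN s hclass θ M hMk hmom
  -- `θ₁` carries no moment condition, so `M = 0`. Only the scale `t = 1` occurs, and a single `n`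
  -- suffices.
  obtain ⟨C₁, -, hlow⟩ := hN s hclass θ₁ 0 (Nat.zero_le _) (by simp)
  obtain ⟨C', hC'⟩ := exists_dyadic_bound
    (F := fun j x => ‖conv (T.localize ρ) (dilate ((2 : ℝ) ^ j) (by positivity) θ) x‖)
    ha hs hp hC hRO (hhigh.mono fun n hn j x =>
      hn ((2 : ℝ) ^ j) (by positivity) (one_le_pow₀ (by norm_num)) x) hD (by linarith)
  obtain ⟨n, hn⟩ := hlow.exists
  refine ⟨max C' (C₁ * (R n * 1 ^ (d + N) + (n : ℝ) ^ s * 1⁻¹ ^ 0)), fun j x => ?_⟩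
  by_cases hj : j = 0
  · have hθ₁ : dilate (1 : ℝ) one_ne_zero θ₁ = θ₁ := by
      ext x
      simp [dilate_apply]
    have := hn 1 one_pos le_rfl x
    rw [hθ₁] at this
    rw [hj, dyadicKernel, if_pos rfl]
    simpa using Or.inr (by simpa using this)
  · rw [dyadicKernel, if_neg hj]
    exact (hC' j x).trans (le_max_left _ _)
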